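/- **Conventions.** Let $\{0,1\}^*$ be the set of all finite bit strings. A *right ideal* is a set $R\subseteq\{0,1\}^*$ with $R\{0,1\}^*\subseteq R$; it is *finitely generated* if $R=C\{0,1\}^*$ for a finite set $C$, and *essential* if it meets every non-empty right ideal. An *isomorphism* of right ideals is a bijection $\varphi:R_1\to R_2$ with $\varphi(xz)=\varphi(x)z$ for all $x\in R_1$, $z\in\{0,1\}^*$. Every isomorphism between finitely generated essential right ideals has a unique maximal extension to such an isomorphism. The *Thompson group* $G_{2,1}$ consists of all maximally extended isomorphisms between finitely generated essential right ideals of $\{0,1\}^*$; its elements act as partial maps on $\{0,1\}^*$ on the left, and the product is composition followed by maximal extension. For $1\le i<j$, $\tau_{i,j}\in G_{2,1}$ is the element that exchanges the $i$-th and the $j$-th letter of all strings of length at least $j$. An element $w\in G_{2,1}$ *stabilizes* $b\{0,1\}^*$ if it maps every element of $b\{0,1\}^*$ on which it is defined into $b\{0,1\}^*$. A *word* over a subset of $G_{2,1}$ is a finite sequence of letters from that subset and formal inverses of such letters. *Circuits* are combinational circuits made of $\wedge$-, $\vee$-, $\neg$- and fork-gates (where $\wedge$, $\vee$ take two adjacent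 wires) and swappings $\tau_{i,j}$ of two wires; the *size* $|C|$ of a circuit $C$ is the number of its gates, including forks and wire-swappings, plus the number of its input ports and output ports. **Theorem (Representation of permutations by the Thompson group).** Let $\Gamma$ be any finite generating set of the group $G_{2,1}$. There is a constant $c$, depending only on $\Gamma$, such that the following holds. Let $g$ be any permutation of $\{0,1\}^m$, and let $C_g$ and $C_{g^{-1}}$ be minimum-size circuits that compute $g$ and $g^{-1}$, respectively. Then there is a word $W$ over $\Gamma\cup\{\tau_{i,i+1}:1\le i\}$, representing an element $w\in G_{2,1}$, such that: 1. for all $x,y\in\{0,1\}^m$, $w(0x)=0\,g(x)$ and $w^{-1}(0y)=0\,g^{-1}(y)$, where $w^{-1}$ is represented by the free-group inverse $W^{-1}$ of the word $W$; 2. $w$ and $w^{-1}$ both stabilize $0\{0,1\}^*$ and $1\{0,1\}^*$; 3. $|W|=|W^{-1}|\le c\,\bigl(|C_g|^4+|C_{g^{-1}}|^4\bigr)$; 4. every subscript of a transposition letter $\tau_{i,i+1}$ (or its inverse) that occurs in $W$ is at most $\max\{|C_g|^2,|C_{g^{-1}}|^2\}+2$. -/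

import Mathlib

/-! ### Combinational circuits

A bit string is a `List Bool`; `false` is the letter 0 and `true` is the letter 1.
`List.Vector Bool m` is the set of bit strings of length `m`. -/

/-- The operations of a combinational circuit. Positions of wires are counted from 1.
The `and`- and `or`-gates take the wires `i` and `i + 1`; `swap i j` exchanges the wires
`i < j`. -/
inductive Gate : Type
  | and (i : ℕ)
  | or (i : ℕ)
  | not (i : ℕ)
  | fork (i : ℕ)
  | swap (i j : ℕ)

/-- `G.Maps s t`: the operation `G`, applied to wires that carry the bits `s` (from top to
bottom), yields wires that carry the bits `t`. -/
inductive Gate.Maps : Gate → List Bool → List Bool → Prop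
  | and (u v : List Bool) (a b : Bool) :
      Gate.Maps (Gate.and (u.length + 1)) (u ++ a :: b :: v) (u ++ (a && b) :: v)
  | or (u v : List Bool) (a b : Bool) :
      Gate.Maps (Gate.or (u.length + 1)) (u ++ a :: b :: v) (u ++ (a || b) :: v)
  | not (u v : List Bool) (a : Bool) :
      Gate.Maps (Gate.not (u.length + 1)) (u ++ a :: v) (u ++ (!a) :: v)
  | fork (u v : List Bool) (a : Bool) :
      Gate.Maps (Gate.fork (u.length + 1)) (u ++ a :: v) (u ++ a :: a :: v)
  | swap (u v w : List Bool) (a b : Bool) :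
      Gate.Maps (Gate.swap (u.length + 1) (u.length + 1 + v.length + 1))
        (u ++ a :: (v ++ b :: w)) (u ++ b :: (v ++ a :: w))

/-- `GatesMap L s t`: performing the operations in the list `L` one after the other, on wires
that carry `s` at the beginning, yields wires that carry `t` at the end. -/
inductive GatesMap : List Gate → List Bool → List Bool → Prop
  | nil (s : List Bool) : GatesMap [] s s
  | cons {G : Gate} {L : List Gate} {s t r : List Bool} :
      G.Maps s t → GatesMap L t r → GatesMap (G :: L) s r

/-- A combinational circuit with `m` input ports and `n` output ports, given by the list of its
operations, read from the input side to the output side. -/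
structure Circuit (m n : ℕ) : Type where
  gates : List Gate
  total : ∀ x : List.Vector Bool m, ∃ y : List.Vector Bool n,
    GatesMap gates x.toList y.toList

namespace Circuit

variable {m n : ℕ}

/-- The size: the number of gates (with forks and wire-swappings), input ports and output
ports. -/
def size (C : Circuit m n) : ℕ := C.gates.length + m + n

/-- `f` is the input-output function of `C`. -/
def Computes (C : Circuit m n) (f : List.Vector Bool m → List.Vector Bool n) : Prop :=
  ∀ x, GatesMap C.gates x.toList (f x).toList

/-- `C` is a circuit of minimum size for `f`. -/
def IsMinimumFor (C : Circuit m n) (f : List.Vector Bool m → List.Vector Bool n) : Prop :=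
  C.Computes f ∧ ∀ D : Circuit m n, D.Computes f → C.size ≤ D.size

end Circuit

/-! ### Right ideals of the free monoid over {0,1} and their isomorphisms -/

def IsRightIdeal (R : Set (List Bool)) : Prop := ∀ x ∈ R, ∀ z, x ++ z ∈ R

/-- `R` intersects every (non-empty) right ideal. -/
def IsEssential (R : Set (List Bool)) : Prop :=
  ∀ J : Set (List Bool), IsRightIdeal J → J.Nonempty → (R ∩ J).Nonempty

/-- `R` is generated, as a right ideal, by a finite set of strings. -/
def IsFinGenRightIdeal (R : Set (List Bool)) : Prop :=
  ∃ C : Set (List Bool), C.Finite ∧ R = {x | ∃ c ∈ C, ∃ z, x = c ++ z}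

/-- Domain of a partial injective map. -/
def pdom (φ : List Bool ≃. List Bool) : Set (List Bool) := {x | ∃ y, y ∈ φ x}

/-- Image of a partial injective map. -/
def pim (φ : List Bool ≃. List Bool) : Set (List Bool) := {y | ∃ x, y ∈ φ x}

/-- `φ` is an isomorphism between finitely generated essential right ideals. -/
structure IsEssIso (φ : List Bool ≃. List Bool) : Prop where
  map_append : ∀ x y z, y ∈ φ x → y ++ z ∈ φ (x ++ z)
  dom_rightIdeal : IsRightIdeal (pdom φ)
  dom_finGen : IsFinGenRightIdeal (pdom φ)
  dom_essential : IsEssential (pdom φ)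
  im_rightIdeal : IsRightIdeal (pim φ)
  im_finGen : IsFinGenRightIdeal (pim φ)
  im_essential : IsEssential (pim φ)

/-- A finitely generated essential right ideal contains all sufficiently long strings. -/
theorem exists_length_mem {R : Set (List Bool)} (hf : IsFinGenRightIdeal R)
    (he : IsEssential R) : ∃ N, ∀ x : List Bool, N ≤ x.length → x ∈ R := by
  obtain ⟨C, hC, rfl⟩ := hf
  obtain ⟨N, hN⟩ := (hC.image List.length).bddAbove
  refine ⟨N, fun x hx => ?_⟩
  obtain ⟨y, ⟨c, hc, z, rfl⟩, t, ht⟩ := he {y | ∃ t, y = x ++ t}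
    (by rintro _ ⟨t, rfl⟩ z; exact ⟨t ++ z, by simp⟩) ⟨x, [], by simp⟩
  have hl : c.length ≤ x.length := (hN ⟨c, hc, rfl⟩).trans hx
  have hp : c <+: x := List.prefix_of_prefix_length_le ⟨z, rfl⟩ ⟨t, ht.symm⟩ hl
  obtain ⟨s, rfl⟩ := hp
  exact ⟨c, hc, s, rfl⟩

theorem finGen_essential_of_length_mem {R : Set (List Bool)} (hR : IsRightIdeal R) (N : ℕ)
    (hN : ∀ x : List Bool, N ≤ x.length → x ∈ R) :
    IsFinGenRightIdeal R ∧ IsEssential R := by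
  refine ⟨⟨{x | x ∈ R ∧ x.length ≤ N}, (List.finite_length_le Bool N).subset
    fun x hx => hx.2, ?_⟩, ?_⟩
  · ext x
    constructor
    · intro hx
      by_cases h : x.length ≤ N
      · exact ⟨x, ⟨hx, h⟩, [], by simp⟩
      · refine ⟨x.take N, ⟨hN _ ?_, ?_⟩, x.drop N, by simp⟩
        · rw [List.length_take]; omega
        · rw [List.length_take]; omega
    · rintro ⟨c, hc, z, rfl⟩
      exact hR c hc.1 z
  · rintro J hJ ⟨x, hx⟩
    exact ⟨x ++ List.replicate N false, hN _ (by simp), hJ x hx _⟩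

theorem pim_eq_pdom_symm (φ : List Bool ≃. List Bool) : pim φ = pdom φ.symm := by
  ext y
  exact exists_congr fun x => (PEquiv.mem_iff_mem φ).symm

namespace IsEssIso

theorem map_append_symm {φ : List Bool ≃. List Bool}
    (h : ∀ x y z, y ∈ φ x → y ++ z ∈ φ (x ++ z)) (x y z : List Bool) (hy : y ∈ φ.symm x) :
    y ++ z ∈ φ.symm (x ++ z) := by
  rw [PEquiv.mem_iff_mem] at hy ⊢
  exact h _ _ _ hy

theorem isRightIdeal_pdom {φ : List Bool ≃. List Bool}
    (h : ∀ x y z, y ∈ φ x → y ++ z ∈ φ (x ++ z)) : IsRightIdeal (pdom φ) := by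
  rintro x ⟨y, hy⟩ z
  exact ⟨y ++ z, h _ _ _ hy⟩

/-- A criterion in terms of long strings. -/
theorem mk_of_length {φ : List Bool ≃. List Bool}
    (h : ∀ x y z, y ∈ φ x → y ++ z ∈ φ (x ++ z))
    (hd : ∃ N, ∀ x : List Bool, N ≤ x.length → x ∈ pdom φ)
    (hi : ∃ N, ∀ x : List Bool, N ≤ x.length → x ∈ pdom φ.symm) : IsEssIso φ := by
  obtain ⟨N, hN⟩ := hd
  obtain ⟨M, hM⟩ := hi
  have h1 := isRightIdeal_pdom h
  have h2 : IsRightIdeal (pim φ) := by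
    rw [pim_eq_pdom_symm]
    exact isRightIdeal_pdom (map_append_symm h)
  rw [← pim_eq_pdom_symm] at hM
  obtain ⟨h3, h4⟩ := finGen_essential_of_length_mem h1 N hN
  obtain ⟨h5, h6⟩ := finGen_essential_of_length_mem h2 M hM
  exact ⟨h, h1, h3, h4, h2, h5, h6⟩

variable {φ ψ : List Bool ≃. List Bool}

theorem exists_dom (h : IsEssIso φ) : ∃ N, ∀ x : List Bool, N ≤ x.length → x ∈ pdom φ :=
  exists_length_mem h.dom_finGen h.dom_essential

theorem symm (h : IsEssIso φ) : IsEssIso φ.symm := by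
  refine ⟨map_append_symm h.map_append, ?_, ?_, ?_, ?_, ?_, ?_⟩
  · rw [← pim_eq_pdom_symm]; exact h.im_rightIdeal
  · rw [← pim_eq_pdom_symm]; exact h.im_finGen
  · rw [← pim_eq_pdom_symm]; exact h.im_essential
  · rw [pim_eq_pdom_symm]; exact h.dom_rightIdeal
  · rw [pim_eq_pdom_symm]; exact h.dom_finGen
  · rw [pim_eq_pdom_symm]; exact h.dom_essential

theorem exists_dom_trans (h : IsEssIso φ) (k : IsEssIso ψ) :
    ∃ N, ∀ x : List Bool, N ≤ x.length → x ∈ pdom (φ.trans ψ) := by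
  obtain ⟨N, hN⟩ := h.exists_dom
  obtain ⟨M, hM⟩ := k.exists_dom
  refine ⟨N + M, fun x hx => ?_⟩
  obtain ⟨y, hy⟩ := hN (x.take N) (by simp; omega)
  obtain ⟨w, hw⟩ := hM (y ++ x.drop N) (by simp; omega)
  have hy2 := h.map_append _ _ (x.drop N) hy
  rw [List.take_append_drop] at hy2
  exact ⟨w, (PEquiv.mem_trans φ ψ x w).2 ⟨_, hy2, hw⟩⟩

theorem trans (h : IsEssIso φ) (k : IsEssIso ψ) : IsEssIso (φ.trans ψ) := by
  refine mk_of_length ?_ (h.exists_dom_trans k) ?_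
  · intro x y z hy
    obtain ⟨w, hw, hy⟩ := (PEquiv.mem_trans φ ψ x y).1 hy
    exact (PEquiv.mem_trans φ ψ _ _).2
      ⟨_, h.map_append _ _ z hw, k.map_append _ _ z hy⟩
  · exact k.symm.exists_dom_trans h.symm

theorem refl : IsEssIso (PEquiv.refl (List Bool)) := by
  refine mk_of_length ?_ ⟨0, fun x _ => ⟨x, by simp⟩⟩ ⟨0, fun x _ => ⟨x, by simp⟩⟩
  intro x y z hy
  simp_all

end IsEssIso

/-! ### Maximal extensions -/

/-- An isomorphism between finitely generated essential right ideals that has no proper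
extension to such an isomorphism. For partial maps, `φ ≤ ψ` says that `ψ` extends `φ`. -/
def IsMaximalEssIso (φ : List Bool ≃. List Bool) : Prop :=
  IsEssIso φ ∧ ∀ ψ : List Bool ≃. List Bool, IsEssIso ψ → φ ≤ ψ → ψ = φ

/-- `x` is sent to `y` by the maximal extension of `φ`. -/
def MaxExtRel (φ : List Bool ≃. List Bool) (x y : List Bool) : Prop :=
  ∃ N, ∀ z : List Bool, N ≤ z.length → y ++ z ∈ φ (x ++ z)

theorem MaxExtRel.symm {φ : List Bool ≃. List Bool} {x y : List Bool}
    (h : MaxExtRel φ x y) : MaxExtRel φ.symm y x := by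
  obtain ⟨N, hN⟩ := h
  exact ⟨N, fun z hz => (PEquiv.mem_iff_mem φ).2 (hN z hz)⟩

theorem MaxExtRel.unique {φ : List Bool ≃. List Bool} {x y w : List Bool}
    (h : MaxExtRel φ x y) (k : MaxExtRel φ x w) : y = w := by
  obtain ⟨N, hN⟩ := h
  obtain ⟨M, hM⟩ := k
  have h1 := hN (List.replicate (N + M) false) (by simp)
  have h2 := hM (List.replicate (N + M) false) (by simp)
  exact List.append_cancel_right (Option.mem_unique h1 h2)

open Classical in
/-- The maximal extension of `φ`; see `maxExt_greatest` and `maxExt_isMaximal`. -/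
noncomputable def maxExt (φ : List Bool ≃. List Bool) : List Bool ≃. List Bool where
  toFun x := if h : ∃ y, MaxExtRel φ x y then some h.choose else none
  invFun y := if h : ∃ x, MaxExtRel φ.symm y x then some h.choose else none
  inv x y := by
    have key : ∀ (χ : List Bool ≃. List Bool) (s t : List Bool),
        (t ∈ if h : ∃ y, MaxExtRel χ s y then some h.choose else none) ↔ MaxExtRel χ s t := by
      intro χ s t
      split_ifs with h
      · simp only [Option.mem_def, Option.some.injEq]
        constructor
        · rintro rfl
          exact h.choose_spec
        · exact fun k => h.choose_spec.unique k
      · simp only [Option.mem_def, reduceCtorEq, false_iff]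
        exact fun k => h ⟨t, k⟩
    exact (key φ.symm y x).trans
      (Iff.trans ⟨fun h => h.symm, fun h => h.symm⟩ (key φ x y).symm)

theorem mem_maxExt {φ : List Bool ≃. List Bool} {x y : List Bool} :
    y ∈ maxExt φ x ↔ MaxExtRel φ x y := by
  classical
  change (y ∈ if h : ∃ y, MaxExtRel φ x y then some h.choose else none) ↔ _
  split_ifs with h
  · simp only [Option.mem_def, Option.some.injEq]
    constructor
    · rintro rfl
      exact h.choose_spec
    · exact fun k => h.choose_spec.unique k
  · simp only [Option.mem_def, reduceCtorEq, false_iff]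
    exact fun k => h ⟨y, k⟩

theorem mem_maxExt_symm {φ : List Bool ≃. List Bool} {x y : List Bool} :
    y ∈ (maxExt φ).symm x ↔ MaxExtRel φ.symm x y := by
  rw [PEquiv.mem_iff_mem, mem_maxExt]
  exact ⟨fun h => h.symm, fun h => h.symm⟩

theorem le_maxExt {φ : List Bool ≃. List Bool} (h : IsEssIso φ) : φ ≤ maxExt φ :=
  fun x y hy => mem_maxExt.2 ⟨0, fun z _ => h.map_append x y z hy⟩

/-- `maxExt φ` extends every extension of `φ`. -/
theorem maxExt_greatest {φ ψ : List Bool ≃. List Bool} (h : IsEssIso φ) (k : IsEssIso ψ)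
    (hle : φ ≤ ψ) : ψ ≤ maxExt φ := by
  obtain ⟨N, hN⟩ := h.exists_dom
  refine fun x y hy => mem_maxExt.2 ⟨N, fun z hz => ?_⟩
  obtain ⟨w, hw⟩ := hN (x ++ z) (by simp; omega)
  have : w = y ++ z := Option.mem_unique (hle _ _ hw) (k.map_append _ _ z hy)
  rwa [← this]

theorem maxExt_isEssIso {φ : List Bool ≃. List Bool} (h : IsEssIso φ) :
    IsEssIso (maxExt φ) := by
  refine IsEssIso.mk_of_length ?_ ?_ ?_
  · intro x y z hy
    obtain ⟨N, hN⟩ := mem_maxExt.1 hy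
    refine mem_maxExt.2 ⟨N, fun t ht => ?_⟩
    rw [List.append_assoc, List.append_assoc]
    exact hN _ (by simp; omega)
  · obtain ⟨N, hN⟩ := h.exists_dom
    refine ⟨N, fun x hx => ?_⟩
    obtain ⟨y, hy⟩ := hN x hx
    exact ⟨y, le_maxExt h _ _ hy⟩
  · obtain ⟨N, hN⟩ := h.symm.exists_dom
    refine ⟨N, fun x hx => ?_⟩
    obtain ⟨y, hy⟩ := hN x hx
    exact ⟨y, mem_maxExt_symm.2 (mem_maxExt.1 (le_maxExt h.symm _ _ hy))⟩

theorem maxExt_isMaximal {φ : List Bool ≃. List Bool} (h : IsEssIso φ) :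
    IsMaximalEssIso (maxExt φ) :=
  ⟨maxExt_isEssIso h, fun _ k hle =>
    le_antisymm (maxExt_greatest h k ((le_maxExt h).trans hle)) hle⟩

theorem IsMaximalEssIso.eq_maxExt {φ ψ : List Bool ≃. List Bool} (h : IsEssIso φ)
    (k : IsMaximalEssIso ψ) (hle : φ ≤ ψ) : ψ = maxExt φ :=
  (k.2 _ (maxExt_isEssIso h) (maxExt_greatest h k.1 hle)).symm

/-! ### The Thompson group -/

/-- The elements of the Thompson group: the maximally extended isomorphisms between finitely
generated essential right ideals of the set of all bit strings. -/
@[ext]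
structure ThompsonG : Type where
  toPEquiv : List Bool ≃. List Bool
  isMaximal : IsMaximalEssIso toPEquiv

namespace ThompsonG

/-- The element that is represented by an isomorphism which need not be maximal. -/
noncomputable def ofEssIso (φ : List Bool ≃. List Bool) (h : IsEssIso φ) : ThompsonG :=
  ⟨maxExt φ, maxExt_isMaximal h⟩

theorem isEssIso (a : ThompsonG) : IsEssIso a.toPEquiv := a.isMaximal.1

theorem eq_of_le {a b : ThompsonG} (χ : List Bool ≃. List Bool) (h : IsEssIso χ)
    (ha : χ ≤ a.toPEquiv) (hb : χ ≤ b.toPEquiv) : a = b :=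
  ThompsonG.ext ((a.isMaximal.eq_maxExt h ha).trans (b.isMaximal.eq_maxExt h hb).symm)

/-- Composition (functions act on the left) followed by maximal extension. -/
noncomputable instance : Mul ThompsonG :=
  ⟨fun a b => ofEssIso (b.toPEquiv.trans a.toPEquiv) (b.isEssIso.trans a.isEssIso)⟩

noncomputable instance : One ThompsonG :=
  ⟨ofEssIso (PEquiv.refl (List Bool)) IsEssIso.refl⟩

/-- The inverse partial map. -/
instance : Inv ThompsonG :=
  ⟨fun a => ⟨a.toPEquiv.symm, a.isEssIso.symm, fun ψ hψ hle => by
    have hle2 : a.toPEquiv ≤ ψ.symm := fun x y hy =>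
      (PEquiv.mem_iff_mem ψ).2 (hle y x ((PEquiv.mem_iff_mem a.toPEquiv).2 hy))
    rw [← a.isMaximal.2 ψ.symm hψ.symm hle2, PEquiv.symm_symm]⟩⟩

theorem trans_le_mul (a b : ThompsonG) :
    b.toPEquiv.trans a.toPEquiv ≤ (a * b).toPEquiv :=
  le_maxExt (b.isEssIso.trans a.isEssIso)

theorem refl_le_one : PEquiv.refl (List Bool) ≤ (1 : ThompsonG).toPEquiv :=
  le_maxExt IsEssIso.refl

theorem inv_toPEquiv (a : ThompsonG) : (a⁻¹).toPEquiv = a.toPEquiv.symm := rfl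

theorem mul_apply {a b : ThompsonG} {x y z : List Bool} (hy : y ∈ b.toPEquiv x)
    (hz : z ∈ a.toPEquiv y) : z ∈ (a * b).toPEquiv x :=
  trans_le_mul a b x z ((PEquiv.mem_trans _ _ _ _).2 ⟨y, hy, hz⟩)

noncomputable instance : Group ThompsonG :=
  Group.ofLeftAxioms
    (fun a b c => by
      refine eq_of_le (c.toPEquiv.trans (b.toPEquiv.trans a.toPEquiv))
        (c.isEssIso.trans (b.isEssIso.trans a.isEssIso)) ?_ ?_
      · intro x w hw
        obtain ⟨y, hy, hw⟩ := (PEquiv.mem_trans _ _ _ _).1 hw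
        exact mul_apply hy (trans_le_mul _ _ _ _ hw)
      · intro x w hw
        obtain ⟨y, hy, hw⟩ := (PEquiv.mem_trans _ _ _ _).1 hw
        obtain ⟨z, hz, hw⟩ := (PEquiv.mem_trans _ _ _ _).1 hw
        exact mul_apply (mul_apply hy hz) hw)
    (fun a => eq_of_le a.toPEquiv a.isEssIso
      (fun _ y hy => mul_apply hy (refl_le_one y y (by simp))) le_rfl)
    (fun a => eq_of_le (a.toPEquiv.trans a.toPEquiv.symm) (a.isEssIso.trans a.isEssIso.symm)
      (trans_le_mul a⁻¹ a)
      (by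
        intro x w hw
        obtain ⟨y, hy, hw⟩ := (PEquiv.mem_trans _ _ _ _).1 hw
        have hx : w = x :=
          Option.mem_unique hw ((PEquiv.mem_iff_mem a.toPEquiv).2 hy)
        exact refl_le_one x w (by simp [hx])))

end ThompsonG

/-! ### Position transpositions -/

/-- The string `x` with the letters at the positions `i` and `j` exchanged (positions are
counted from 0 here, and both have to be smaller than the length). -/
def swapLetters (i j : ℕ) (x : List Bool) : List Bool :=
  List.ofFn fun k : Fin x.length => x.getD (Equiv.swap i j k) false

@[simp] theorem length_swapLetters (i j : ℕ) (x : List Bool) :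
    (swapLetters i j x).length = x.length := by
  simp [swapLetters]

theorem swap_lt {i j k n : ℕ} (hi : i < n) (hj : j < n) (hk : k < n) :
    Equiv.swap i j k < n := by
  rw [Equiv.swap_apply_def]
  split_ifs <;> assumption

theorem getElem_swapLetters {i j : ℕ} {x : List Bool} {k : ℕ}
    (hk : k < (swapLetters i j x).length) :
    (swapLetters i j x)[k] = x.getD (Equiv.swap i j k) false := by
  simp [swapLetters]

theorem swapLetters_swapLetters {i j : ℕ} {x : List Bool} (hi : i < x.length)
    (hj : j < x.length) : swapLetters i j (swapLetters i j x) = x := by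
  refine List.ext_getElem (by simp) fun k h1 h2 => ?_
  have h3 := swap_lt hi hj h2
  rw [getElem_swapLetters, List.getD_eq_getElem _ _ (by simpa using h3), getElem_swapLetters,
    Equiv.swap_apply_self, List.getD_eq_getElem _ _ h2]

theorem swapLetters_append {i j : ℕ} {x : List Bool} (hi : i < x.length)
    (hj : j < x.length) (z : List Bool) :
    swapLetters i j (x ++ z) = swapLetters i j x ++ z := by
  refine List.ext_getElem (by simp) fun k h1 h2 => ?_
  rw [getElem_swapLetters, List.getElem_append]
  split_ifs with h
  · have h3 : k < x.length := by simpa using h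
    have h4 := swap_lt hi hj h3
    rw [getElem_swapLetters, List.getD_append _ _ _ _ h4]
  · have h3 : x.length ≤ k := by simpa using h
    rw [Equiv.swap_apply_of_ne_of_ne (by omega) (by omega),
      List.getD_eq_getElem _ _ (by simpa using h1), List.getElem_append_right h3]
    simp

/-- The partial map that exchanges the letters number `i` and `j` (counted from 1) of the
strings of length at least `j`. -/
def tauPEquiv (i j : ℕ) (hi : 1 ≤ i) (hij : i < j) : List Bool ≃. List Bool where
  toFun x := if j ≤ x.length then some (swapLetters (i - 1) (j - 1) x) else none
  invFun x := if j ≤ x.length then some (swapLetters (i - 1) (j - 1) x) else none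
  inv x y := by
    have key : ∀ s t : List Bool,
        (t ∈ if j ≤ s.length then some (swapLetters (i - 1) (j - 1) s) else none) →
        (s ∈ if j ≤ t.length then some (swapLetters (i - 1) (j - 1) t) else none) := by
      intro s t h
      split_ifs at h with hs
      · simp only [Option.mem_def, Option.some.injEq] at h
        subst h
        rw [length_swapLetters, if_pos hs,
          swapLetters_swapLetters (by omega) (by omega)]
        rfl
      · simp at h
    exact ⟨key y x, key x y⟩

theorem mem_tauPEquiv {i j : ℕ} {hi : 1 ≤ i} {hij : i < j} {x y : List Bool} :
    y ∈ tauPEquiv i j hi hij x ↔ j ≤ x.length ∧ y = swapLetters (i - 1) (j - 1) x := by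
  change (y ∈ if j ≤ x.length then some (swapLetters (i - 1) (j - 1) x) else none) ↔ _
  split_ifs with h
  · simp [h, eq_comm]
  · simp [h]

theorem tauPEquiv_isEssIso (i j : ℕ) (hi : 1 ≤ i) (hij : i < j) :
    IsEssIso (tauPEquiv i j hi hij) := by
  have hd : ∀ x : List Bool, j ≤ x.length → x ∈ pdom (tauPEquiv i j hi hij) :=
    fun x hx => ⟨_, mem_tauPEquiv.2 ⟨hx, rfl⟩⟩
  refine IsEssIso.mk_of_length ?_ ⟨j, hd⟩ ⟨j, hd⟩
  intro x y z hy
  obtain ⟨hx, rfl⟩ := mem_tauPEquiv.1 hy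
  exact mem_tauPEquiv.2 ⟨by simp; omega, (swapLetters_append (by omega) (by omega) z).symm⟩

/-- The position transposition `τ_{i,j}`, for `1 ≤ i < j`, as an element of the Thompson
group. -/
noncomputable def tau (i j : ℕ) (hi : 1 ≤ i) (hij : i < j) : ThompsonG :=
  ThompsonG.ofEssIso (tauPEquiv i j hi hij) (tauPEquiv_isEssIso i j hi hij)

/-! ### Words over a generating set and the position transpositions -/

/-- The letters of the alphabet `Γ ∪ {τ_{i,i+1} : 1 ≤ i}`. -/
inductive Letter (Γ : Set ThompsonG) : Type
  | gen (γ : Γ)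
  | trans (i : ℕ) (hi : 1 ≤ i)

/-- The element of the group that a letter denotes. -/
noncomputable def Letter.val {Γ : Set ThompsonG} : Letter Γ → ThompsonG
  | Letter.gen γ => γ.1
  | Letter.trans i hi => tau i (i + 1) hi (Nat.lt_succ_self i)

/-- Group words over the alphabet `Γ ∪ {τ_{i,i+1} : 1 ≤ i}`: the pair `(a, true)` stands for
the letter `a`, and `(a, false)` for its inverse. -/
abbrev GroupWord (Γ : Set ThompsonG) : Type := List (Letter Γ × Bool)

/-- The element of the Thompson group that a word represents. -/
noncomputable def GroupWord.value {Γ : Set ThompsonG} (W : GroupWord Γ) : ThompsonG :=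
  FreeGroup.lift Letter.val (FreeGroup.mk W)

/-- `a` stabilizes the right ideal of all strings that begin with the letter `b`. -/
def ThompsonG.Stabilizes (a : ThompsonG) (b : Bool) : Prop :=
  ∀ x y : List Bool, y ∈ a.toPEquiv (b :: x) → ∃ z : List Bool, y = b :: z

/-! ### Idea of the proof

A circuit is simulated by gates `c ↦ c ⊕ f(a, b)`, which are their own inverses: each `∧`-, `∨`- or
`¬`-gate writes its output to a fresh cell that holds `0`, while forks and wire-swappings only
change which cells the wires are read from. Computing, copying the output and undoing the
computation turns circuits for `g` and `g⁻¹` into the maps `(x, y) ↦ (x, y ⊕ g x)` and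
`(x, y) ↦ (x ⊕ g⁻¹ y, y)`, with all the other cells restored. Hence `(x, 0)` is taken to `(x, g x)`,
to `(0, g x)` and, by copying back and forth, to `(g x, 0)`.

For the letters in the first three positions such a gate is an element of the Thompson group, one of
finitely many; on other positions it is conjugated by a product of transpositions `τ_{i,i+1}`. The
zeros in which the simulation works are supplied by the element `0 ↦ 00`, `10 ↦ 01`, `11 ↦ 1`, whose
`k`-th power puts `k` zeros in front of `0x`. -/

open scoped symmDiff

/-! ### Words of bounded length -/

namespace ThompsonG

variable {a : ThompsonG} {b : Bool} {x y : List Bool}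

theorem mem_inv : y ∈ (a⁻¹).toPEquiv x ↔ x ∈ a.toPEquiv y :=
  PEquiv.mem_iff_mem a.toPEquiv

theorem mem_one (x : List Bool) : x ∈ (1 : ThompsonG).toPEquiv x :=
  refl_le_one x x rfl

theorem append_mem (h : y ∈ a.toPEquiv x) (z : List Bool) : y ++ z ∈ a.toPEquiv (x ++ z) :=
  a.isEssIso.map_append x y z h

theorem pow_apply {f : ℕ → List Bool} (h : ∀ n, f (n + 1) ∈ a.toPEquiv (f n)) (n : ℕ) :
    f n ∈ (a ^ n).toPEquiv (f 0) := by
  induction n with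
  | zero => simpa only [pow_zero] using mem_one (f 0)
  | succ n ih => simpa only [pow_succ'] using mul_apply ih (h n)

theorem stabilizes_of_forall_length_eq {m : ℕ}
    (h : ∀ x : List Bool, x.length = m → ∃ y, b :: y ∈ a.toPEquiv (b :: x)) :
    a.Stabilizes b := by
  intro x y hy
  have long (z : List Bool) (hz : m ≤ z.length) : ∃ t, y ++ z = b :: t := by
    have hlen : m ≤ (x ++ z).length := by grind
    obtain ⟨u, hu⟩ := h ((x ++ z).take m) (by simpa using hlen)
    have hmem := append_mem hu ((x ++ z).drop m)
    rw [List.cons_append, List.take_append_drop] at hmem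
    exact ⟨_, Option.mem_unique (append_mem hy z) hmem⟩
  cases y with
  | nil =>
    obtain ⟨t, ht⟩ := long ((!b) :: List.replicate m false) (by simp)
    simp at ht
  | cons c y =>
    obtain ⟨t, ht⟩ := long (List.replicate m false) (by simp)
    exact ⟨y, by rw [(List.cons.inj ht).1]⟩

theorem Stabilizes.not_of_inv (h : (a⁻¹).Stabilizes b) : a.Stabilizes (!b) := by
  intro x y hy
  have ne_cons (z w : List Bool) : y ++ z ≠ b :: w := fun hw => by
    obtain ⟨t, ht⟩ := h w _ (mem_inv.2 (hw ▸ append_mem hy z))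
    simp at ht
  cases y with
  | nil => exact (ne_cons [b] [] rfl).elim
  | cons c y =>
    have hc : c ≠ b := fun hc => ne_cons [] y (by simp [hc])
    exact ⟨y, by rw [Bool.eq_not.2 hc]⟩

end ThompsonG

namespace GroupWord

variable {Γ : Set ThompsonG}

theorem value_nil : value ([] : GroupWord Γ) = 1 :=
  map_one (FreeGroup.lift Letter.val)

theorem value_singleton (a : Letter Γ) : value [(a, true)] = a.val :=
  FreeGroup.lift_apply_of

theorem value_append (U V : GroupWord Γ) : value (U ++ V) = value U * value V :=
  map_mul (FreeGroup.lift Letter.val) (FreeGroup.mk U) (FreeGroup.mk V)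

theorem value_invRev (W : GroupWord Γ) : value (FreeGroup.invRev W) = (value W)⁻¹ :=
  map_inv (FreeGroup.lift Letter.val) (FreeGroup.mk W)

end GroupWord

/-- `a` is represented by a word over `Γ` and the position transpositions that has at most `ℓ`
letters and whose transpositions `τ_{i,i+1}` have all their subscripts `i + 1` at most `N`. In
particular, for `N = 0` it is a word over `Γ` alone. -/
def HasWord (Γ : Set ThompsonG) (N ℓ : ℕ) (a : ThompsonG) : Prop :=
  ∃ W : GroupWord Γ, W.value = a ∧ W.length ≤ ℓ ∧
    ∀ (i : ℕ) (hi : 1 ≤ i) (e : Bool), (Letter.trans i hi, e) ∈ W → i + 1 ≤ N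

namespace HasWord

variable {Γ : Set ThompsonG} {N N' ℓ ℓ' : ℕ} {a b : ThompsonG}

theorem mono (h : HasWord Γ N ℓ a) (hN : N ≤ N') (hℓ : ℓ ≤ ℓ') : HasWord Γ N' ℓ' a := by
  obtain ⟨W, hW, hlen, hsub⟩ := h
  exact ⟨W, hW, hlen.trans hℓ, fun i hi e he => (hsub i hi e he).trans hN⟩

theorem one : HasWord Γ N ℓ 1 :=
  ⟨[], GroupWord.value_nil, Nat.zero_le _, by simp⟩

theorem of_mem (ha : a ∈ Γ) : HasWord Γ N 1 a :=
  ⟨[(Letter.gen ⟨a, ha⟩, true)], GroupWord.value_singleton _, le_rfl, by simp⟩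

theorem tau_succ {i : ℕ} (hi : 1 ≤ i) (hN : i + 1 ≤ N) :
    HasWord Γ N 1 (tau i (i + 1) hi i.lt_succ_self) :=
  ⟨[(Letter.trans i hi, true)], GroupWord.value_singleton _, le_rfl, by grind⟩

theorem mul (ha : HasWord Γ N ℓ a) (hb : HasWord Γ N ℓ' b) : HasWord Γ N (ℓ + ℓ') (a * b) := by
  obtain ⟨U, rfl, hU, hsubU⟩ := ha
  obtain ⟨V, rfl, hV, hsubV⟩ := hb
  refine ⟨U ++ V, GroupWord.value_append U V, ?_, fun i hi e he => ?_⟩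
  · simpa only [List.length_append] using Nat.add_le_add hU hV
  · exact (List.mem_append.1 he).elim (hsubU i hi e) (hsubV i hi e)

theorem inv (ha : HasWord Γ N ℓ a) : HasWord Γ N ℓ a⁻¹ := by
  obtain ⟨W, rfl, hlen, hsub⟩ := ha
  refine ⟨FreeGroup.invRev W, GroupWord.value_invRev W, by rwa [FreeGroup.invRev_length],
    fun i hi e he => hsub i hi (!e) ?_⟩
  simp only [FreeGroup.invRev, List.mem_reverse, List.mem_map, Prod.mk.injEq] at he
  obtain ⟨⟨x, d⟩, hx, rfl, rfl⟩ := he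
  simpa only [Bool.not_not] using hx

theorem pow (ha : HasWord Γ N ℓ a) (k : ℕ) : HasWord Γ N (k * ℓ) (a ^ k) := by
  induction k with
  | zero => simpa only [pow_zero] using one
  | succ k ih => simpa only [pow_succ, Nat.succ_mul] using ih.mul ha

theorem exists_of_mem_closure (ha : a ∈ Subgroup.closure Γ) : ∃ ℓ, HasWord Γ N ℓ a := by
  induction ha using Subgroup.closure_induction with
  | mem _ hx => exact ⟨1, of_mem hx⟩
  | one => exact ⟨0, one⟩
  | mul _ _ _ _ hx hy => exact ⟨_, hx.choose_spec.mul hy.choose_spec⟩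
  | inv _ _ hx => exact ⟨_, hx.choose_spec.inv⟩

theorem exists_uniform {S : Set ThompsonG} (hS : S.Finite) (hSΓ : S ⊆ Subgroup.closure Γ) :
    ∃ ℓ, ∀ a ∈ S, HasWord Γ N ℓ a := by
  choose! len hlen using fun a (ha : a ∈ S) => exists_of_mem_closure (N := N) (hSΓ ha)
  obtain ⟨ℓ, hℓ⟩ := (hS.image len).bddAbove
  exact ⟨ℓ, fun a ha => (hlen a ha).mono le_rfl (hℓ (Set.mem_image_of_mem len ha))⟩

end HasWord

/-- The prefix substitution `0 ↦ 00`, `10 ↦ 01`, `11 ↦ 1`; it puts an additional `0` in front of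
the strings that begin with `0`. -/
def shiftPEquiv : List Bool ≃. List Bool where
  toFun
    | false :: z => some (false :: false :: z)
    | true :: false :: z => some (false :: true :: z)
    | true :: true :: z => some (true :: z)
    | _ => none
  invFun
    | false :: false :: z => some (false :: z)
    | false :: true :: z => some (true :: false :: z)
    | true :: z => some (true :: true :: z)
    | _ => none
  inv x y := by
    rcases x with _ | ⟨_ | _, _ | ⟨_ | _, x⟩⟩ <;>
      rcases y with _ | ⟨_ | _, _ | ⟨_ | _, y⟩⟩ <;> constructor <;> rintro ⟨⟩ <;> rfl

theorem shiftPEquiv_isEssIso : IsEssIso shiftPEquiv := by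
  refine IsEssIso.mk_of_length (fun x y z h => ?_) ⟨2, fun x hx => ?_⟩ ⟨2, fun x hx => ?_⟩
  · rcases x with _ | ⟨_ | _, _ | ⟨_ | _, x⟩⟩ <;> cases h <;> rfl
  · rcases x with _ | ⟨_ | _, _ | ⟨_ | _, x⟩⟩ <;> first | exact ⟨_, rfl⟩ | simp at hx
  · rcases x with _ | ⟨_ | _, _ | ⟨_ | _, x⟩⟩ <;> first | exact ⟨_, rfl⟩ | simp at hx

/-- The element of the Thompson group that prepends `0` to the strings that begin with `0`. -/
noncomputable def shiftElt : ThompsonG :=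
  ThompsonG.ofEssIso shiftPEquiv shiftPEquiv_isEssIso

theorem shiftElt_pow_apply (k : ℕ) (z : List Bool) :
    List.replicate (k + 1) false ++ z ∈ (shiftElt ^ k).toPEquiv (false :: z) :=
  ThompsonG.pow_apply (f := fun k => List.replicate (k + 1) false ++ z)
    (fun _ => le_maxExt shiftPEquiv_isEssIso _ _ rfl) k

/-- The map `a b c z ↦ a b (c ⊕ f(a, b)) z`. -/
def xorPEquiv (f : Bool → Bool → Bool) : List Bool ≃. List Bool where
  toFun
    | a :: b :: c :: z => some (a :: b :: (c ^^ f a b) :: z)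
    | _ => none
  invFun
    | a :: b :: c :: z => some (a :: b :: (c ^^ f a b) :: z)
    | _ => none
  inv x y := by
    rcases x with _ | ⟨a, _ | ⟨b, _ | ⟨c, x⟩⟩⟩ <;>
      rcases y with _ | ⟨a', _ | ⟨b', _ | ⟨c', y⟩⟩⟩ <;>
      constructor <;> rintro ⟨⟩ <;> simp

theorem xorPEquiv_isEssIso (f : Bool → Bool → Bool) : IsEssIso (xorPEquiv f) := by
  have mem_pdom (x : List Bool) (hx : 3 ≤ x.length) : x ∈ pdom (xorPEquiv f) := by
    rcases x with _ | ⟨a, _ | ⟨b, _ | ⟨c, x⟩⟩⟩ <;> first | exact ⟨_, rfl⟩ | simp at hx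
  refine IsEssIso.mk_of_length (fun x y z h => ?_) ⟨3, mem_pdom⟩ ⟨3, mem_pdom⟩
  rcases x with _ | ⟨a, _ | ⟨b, _ | ⟨c, x⟩⟩⟩ <;> cases h
  rfl

/-- The element of the Thompson group that adds `f(a, b)` to the third letter, where `a` and `b`
are the first two letters. -/
noncomputable def xorElt (f : Bool → Bool → Bool) : ThompsonG :=
  ThompsonG.ofEssIso (xorPEquiv f) (xorPEquiv_isEssIso f)

theorem xorElt_apply (f : Bool → Bool → Bool) (a b c : Bool) (z : List Bool) :
    a :: b :: (c ^^ f a b) :: z ∈ (xorElt f).toPEquiv (a :: b :: c :: z) :=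
  le_maxExt (xorPEquiv_isEssIso f) _ _ rfl

/-! ### Memories and reversible gates -/

/-- A reversible gate on a memory `ι → Bool`: it adds `func`, applied to the two control bits, to
the target bit. The controls may coincide. -/
structure XorGate (ι : Type*) where
  control₁ : ι
  control₂ : ι
  target : ι
  func : Bool → Bool → Bool
  control₁_ne_target : control₁ ≠ target
  control₂_ne_target : control₂ ≠ target

namespace XorGate

variable {ι : Type*} [DecidableEq ι]

/-- The memory after the gate has been applied. -/
def run (o : XorGate ι) (M : ι → Bool) : ι → Bool :=
  Function.update M o.target (M o.target ^^ o.func (M o.control₁) (M o.control₂))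

/-- The memory after the gates have been applied, from the head of the list on. -/
def runAll (l : List (XorGate ι)) (M : ι → Bool) : ι → Bool :=
  l.foldl (fun M o => o.run M) M

variable {o : XorGate ι} {l : List (XorGate ι)} {M v : ι → Bool} {i : ι}

theorem run_of_ne (h : i ≠ o.target) : o.run M i = M i :=
  Function.update_of_ne h _ _

theorem run_run (o : XorGate ι) (M : ι → Bool) : o.run (o.run M) = M := by
  simp [run, Function.update_of_ne, o.control₁_ne_target, o.control₂_ne_target]

theorem run_symmDiff (h₁ : v o.control₁ = false) (h₂ : v o.control₂ = false) :
    o.run (M ∆ v) = o.run M ∆ v := by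
  ext i
  by_cases h : i = o.target
  · subst h
    simp only [run, Function.update_self, Pi.symmDiff_apply, Bool.symmDiff_eq_xor, h₁, h₂,
      Bool.xor_false]
    exact Bool.xor_right_comm _ _ _
  · rw [run_of_ne h, Pi.symmDiff_apply, Pi.symmDiff_apply, run_of_ne h]

theorem runAll_nil (M : ι → Bool) : runAll [] M = M :=
  rfl

theorem runAll_cons (o : XorGate ι) (l : List (XorGate ι)) (M : ι → Bool) :
    runAll (o :: l) M = runAll l (o.run M) :=
  rfl

theorem runAll_append (l l' : List (XorGate ι)) (M : ι → Bool) :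
    runAll (l ++ l') M = runAll l' (runAll l M) :=
  List.foldl_append

theorem runAll_of_forall_ne (h : ∀ o ∈ l, i ≠ o.target) : runAll l M i = M i := by
  induction l generalizing M with
  | nil => rfl
  | cons o l ih =>
    rw [List.forall_mem_cons] at h
    rw [runAll_cons, ih h.2, run_of_ne h.1]

theorem runAll_reverse_runAll (l : List (XorGate ι)) (M : ι → Bool) :
    runAll l.reverse (runAll l M) = M := by
  induction l generalizing M with
  | nil => rfl
  | cons o l ih =>
    rw [runAll_cons, List.reverse_cons, runAll_append, ih, runAll_cons, runAll_nil, run_run]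

theorem runAll_symmDiff (h : ∀ o ∈ l, v o.control₁ = false ∧ v o.control₂ = false) :
    runAll l (M ∆ v) = runAll l M ∆ v := by
  induction l generalizing M with
  | nil => rfl
  | cons o l ih =>
    rw [List.forall_mem_cons] at h
    rw [runAll_cons, runAll_cons, run_symmDiff h.1.1 h.1.2, ih h.2]

theorem runAll_apply_target (hl : (l.map target).Nodup)
    (hc : ∀ o ∈ l, ∀ o' ∈ l, o.control₁ ≠ o'.target ∧ o.control₂ ≠ o'.target) (ho : o ∈ l) :
    runAll l M o.target = (M o.target ^^ o.func (M o.control₁) (M o.control₂)) := by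
  obtain ⟨l₁, l₂, rfl⟩ := List.append_of_mem ho
  have hne : ∀ o' ∈ l₁ ++ l₂, o.target ≠ o'.target := by
    intro o' ho' h
    rw [List.map_append, List.map_cons, List.nodup_middle, List.nodup_cons, ← List.map_append] at hl
    exact hl.1 (h ▸ List.mem_map_of_mem ho')
  have unchanged {i : ι} (hi : ∀ o' ∈ l₁, i ≠ o'.target) : runAll l₁ M i = M i :=
    runAll_of_forall_ne hi
  rw [runAll_append, runAll_cons,
    runAll_of_forall_ne fun o' h => hne o' (List.mem_append_right l₁ h), run,
    Function.update_self, unchanged fun o' h => hne o' (List.mem_append_left l₂ h),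
    unchanged fun o' h => (hc o ho o' (List.mem_append_left _ h)).1,
    unchanged fun o' h => (hc o ho o' (List.mem_append_left _ h)).2]

end XorGate

/-- The memory whose cells `r 0, …, r (m - 1)` hold the letters of `x` and whose other cells are
`0`. It is meaningful for injective `r`. -/
noncomputable def loadRegister {ι : Type*} {m : ℕ} (r : Fin m → ι) (x : List.Vector Bool m) :
    ι → Bool :=
  Function.extend r x.get ⊥

/-- The string in the cells `r 0, …, r (m - 1)` of the memory `M`. -/
def readRegister {ι : Type*} {m : ℕ} (r : Fin m → ι) (M : ι → Bool) : List.Vector Bool m :=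
  List.Vector.ofFn fun i => M (r i)

section Register

variable {ι : Type*} {m n : ℕ} {r : Fin m → ι} {M : ι → Bool}

theorem loadRegister_apply (hr : r.Injective) (x : List.Vector Bool m) (i : Fin m) :
    loadRegister r x (r i) = x.get i :=
  hr.extend_apply _ _ i

theorem loadRegister_of_forall_ne (x : List.Vector Bool m) {i : ι} (h : ∀ j, r j ≠ i) :
    loadRegister r x i = false :=
  Function.extend_apply' _ _ _ fun ⟨j, hj⟩ => h j hj

theorem toList_readRegister (r : Fin m → ι) (M : ι → Bool) :
    (readRegister r M).toList = (List.ofFn r).map M := by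
  rw [readRegister, List.Vector.toList_ofFn, List.map_ofFn]
  rfl

theorem readRegister_loadRegister (hr : r.Injective) (x : List.Vector Bool m) :
    readRegister r (loadRegister r x) = x := by
  simp only [readRegister, loadRegister_apply hr, List.Vector.ofFn_get]

theorem readRegister_symmDiff_loadRegister {r' : Fin n → ι} (h : ∀ i j, r' i ≠ r j)
    (y : List.Vector Bool n) : readRegister r (M ∆ loadRegister r' y) = readRegister r M := by
  simp only [readRegister, Pi.symmDiff_apply, loadRegister_of_forall_ne y fun j => h j _,
    Bool.symmDiff_eq_xor, Bool.xor_false]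

end Register

namespace XorGate

variable {ι : Type*} {n : ℕ}

/-- The gates that add the letters in the cells `p 0, …, p (n - 1)` to those in the cells
`Y 0, …, Y (n - 1)`. -/
def copyGates (p Y : Fin n → ι) (hne : ∀ i j, p i ≠ Y j) : List (XorGate ι) :=
  List.ofFn fun i => ⟨p i, p i, Y i, fun a _ => a, hne i i, hne i i⟩

theorem length_copyGates {p Y : Fin n → ι} (hne : ∀ i j, p i ≠ Y j) :
    (copyGates p Y hne).length = n :=
  List.length_ofFn

theorem runAll_copyGates [DecidableEq ι] {p Y : Fin n → ι} (hY : Y.Injective)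
    (hne : ∀ i j, p i ≠ Y j) (M : ι → Bool) :
    runAll (copyGates p Y hne) M = M ∆ loadRegister Y (readRegister p M) := by
  have hnodup : ((copyGates p Y hne).map target).Nodup := by
    rw [copyGates, List.map_ofFn, List.nodup_ofFn]
    exact hY
  have hcontrol : ∀ o ∈ copyGates p Y hne, ∀ o' ∈ copyGates p Y hne,
      o.control₁ ≠ o'.target ∧ o.control₂ ≠ o'.target := by
    simp only [copyGates, List.forall_mem_ofFn_iff]
    exact fun i j => ⟨hne i j, hne i j⟩
  ext k
  rw [Pi.symmDiff_apply, Bool.symmDiff_eq_xor]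
  by_cases hk : ∃ j, Y j = k
  · obtain ⟨j, rfl⟩ := hk
    rw [loadRegister_apply hY, readRegister, List.Vector.get_ofFn]
    exact runAll_apply_target hnodup hcontrol (List.mem_ofFn.2 ⟨j, rfl⟩)
  · push Not at hk
    rw [loadRegister_of_forall_ne _ hk, Bool.xor_false]
    refine runAll_of_forall_ne ?_
    simp only [copyGates, List.forall_mem_ofFn_iff]
    exact fun j => (hk j).symm

end XorGate

/-! ### Simulation of circuits -/

theorem Gate.Maps.unique {G : Gate} {s t t' : List Bool} (h : G.Maps s t) (h' : G.Maps s t') :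
    t = t' := by
  generalize hs : s = s' at h'
  generalize hG : G = G' at h'
  cases h <;> cases h' <;> simp only [Gate.and.injEq, Gate.or.injEq, Gate.not.injEq,
    Gate.fork.injEq, Gate.swap.injEq, reduceCtorEq] at hG
  all_goals grind [List.append_inj]

theorem gatesMap_singleton {G : Gate} {s t : List Bool} : GatesMap [G] s t ↔ G.Maps s t := by
  constructor
  · rintro (_ | ⟨h, ⟨⟩⟩)
    exact h
  · exact fun h => .cons h (.nil t)

/-- `l` simulates the circuit operations `L` with the help of the cells in `fresh`, which have to
be `0` at first: if the wires carry the bits in the cells `p` before `L`, then they carry the bits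
in the cells `p'` after `L`, once `l` has been applied to the memory. -/
structure Simulates {ι : Type*} [DecidableEq ι] (l : List (XorGate ι)) (L : List Gate)
    (fresh p p' : List ι) : Prop where
  length_le : l.length ≤ L.length
  target_mem : ∀ o ∈ l, o.target ∈ fresh
  control_mem : ∀ o ∈ l, o.control₁ ∈ p ++ fresh ∧ o.control₂ ∈ p ++ fresh
  wires_subset : p' ⊆ p ++ fresh
  map_runAll : ∀ M t, (∀ i ∈ fresh, M i = false) → GatesMap L (p.map M) t →
    p'.map (XorGate.runAll l M) = t

namespace Simulates

open XorGate

variable {ι : Type*} [DecidableEq ι] {G : Gate} {L : List Gate} {fresh fresh' p p' p'' : List ι}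

theorem nil (fresh p : List ι) : Simulates [] [] fresh p p where
  length_le := le_rfl
  target_mem := by simp
  control_mem := by simp
  wires_subset := List.subset_append_left p fresh
  map_runAll M t _ h := by
    generalize hs : p.map M = s at h
    cases h
    exact hs

theorem of_forall_not_maps (fresh p : List ι) (h : ∀ M t, ¬ G.Maps (p.map M) t) :
    Simulates [] [G] fresh p p where
  length_le := Nat.zero_le _
  target_mem := by simp
  control_mem := by simp
  wires_subset := List.subset_append_left p fresh
  map_runAll M t _ hG := (h M t (gatesMap_singleton.1 hG)).elim

theorem of_rewiring (fresh : List ι) (hp' : p' ⊆ p) (h : ∀ M, G.Maps (p.map M) (p'.map M)) :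
    Simulates [] [G] fresh p p' where
  length_le := Nat.zero_le _
  target_mem := by simp
  control_mem := by simp
  wires_subset := List.subset_append_of_subset_left _ hp'
  map_runAll M _ _ hG := (h M).unique (gatesMap_singleton.1 hG)

theorem of_xorGate {o : XorGate ι} {u v : List ι} (hu : u ⊆ p) (hv : v ⊆ p)
    (h₁ : o.control₁ ∈ p) (h₂ : o.control₂ ∈ p) (ho : o.target ∉ p)
    (h : ∀ M, G.Maps (p.map M)
      (u.map M ++ o.func (M o.control₁) (M o.control₂) :: v.map M)) :
    Simulates [o] [G] [o.target] p (u ++ o.target :: v) where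
  length_le := le_rfl
  target_mem := by simp
  control_mem := by simp [h₁, h₂]
  wires_subset := by grind
  map_runAll M t hM hG := by
    have map_run {w : List ι} (hw : w ⊆ p) : w.map (o.run M) = w.map M :=
      List.map_congr_left fun i hi => run_of_ne fun hio => ho (hio ▸ hw hi)
    rw [← (h M).unique (gatesMap_singleton.1 hG), runAll_cons, runAll_nil, List.map_append,
      List.map_cons, map_run hu, map_run hv, run, Function.update_self,
      hM _ (List.mem_singleton_self _), Bool.false_xor]

theorem cons {l l' : List (XorGate ι)} (h : Simulates l [G] fresh p p')
    (h' : Simulates l' L fresh' p' p'') (hfresh : fresh.Disjoint fresh') :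
    Simulates (l ++ l') (G :: L) (fresh ++ fresh') p p'' where
  length_le := by grind [h.length_le, h'.length_le]
  target_mem := by grind [h.target_mem, h'.target_mem]
  control_mem o ho := by
    obtain ho | ho := List.mem_append.1 ho
    · grind [h.control_mem o ho]
    · grind [h'.control_mem o ho, h.wires_subset]
  wires_subset := by grind [h.wires_subset, h'.wires_subset]
  map_runAll M t hM hL := by
    generalize hs : p.map M = s at hL
    obtain _ | ⟨hG, hL⟩ := hL
    subst hs
    rw [runAll_append]
    refine h'.map_runAll _ t (fun i hi => ?_) ?_
    · rw [runAll_of_forall_ne fun o ho hio => hfresh (h.target_mem o ho) (hio ▸ hi)]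
      exact hM i (List.mem_append_right _ hi)
    · rwa [h.map_runAll M _ (fun i hi => hM i (List.mem_append_left _ hi))
        (gatesMap_singleton.2 hG)]

theorem exists_gate_of_maps {q : ι} (hq : q ∉ p) {M : ι → Bool} {t : List Bool}
    (hG : G.Maps (p.map M) t) : ∃ l p', Simulates l [G] [q] p p' := by
  generalize hs : p.map M = s at hG
  cases hG with
  | and =>
    obtain ⟨u, x, rfl, rfl, hx⟩ := List.map_eq_append_iff.1 hs
    obtain ⟨i, y, rfl, rfl, hy⟩ := List.map_eq_cons_iff.1 hx
    obtain ⟨j, v, rfl, rfl, rfl⟩ := List.map_eq_cons_iff.1 hy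
    exact ⟨_, _, .of_xorGate (o := ⟨i, j, q, and, by grind, by grind⟩) (u := u) (v := v)
      (by grind) (by grind) (by simp) (by simp) hq fun M => by
        simpa using Gate.Maps.and (u.map M) (v.map M) (M i) (M j)⟩
  | or =>
    obtain ⟨u, x, rfl, rfl, hx⟩ := List.map_eq_append_iff.1 hs
    obtain ⟨i, y, rfl, rfl, hy⟩ := List.map_eq_cons_iff.1 hx
    obtain ⟨j, v, rfl, rfl, rfl⟩ := List.map_eq_cons_iff.1 hy
    exact ⟨_, _, .of_xorGate (o := ⟨i, j, q, or, by grind, by grind⟩) (u := u) (v := v)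
      (by grind) (by grind) (by simp) (by simp) hq fun M => by
        simpa using Gate.Maps.or (u.map M) (v.map M) (M i) (M j)⟩
  | not =>
    obtain ⟨u, x, rfl, rfl, hx⟩ := List.map_eq_append_iff.1 hs
    obtain ⟨i, v, rfl, rfl, rfl⟩ := List.map_eq_cons_iff.1 hx
    exact ⟨_, _, .of_xorGate (o := ⟨i, i, q, fun a _ => !a, by grind, by grind⟩) (u := u) (v := v)
      (by grind) (by grind) (by simp) (by simp) hq fun M => by
        simpa using Gate.Maps.not (u.map M) (v.map M) (M i)⟩
  | fork =>
    obtain ⟨u, x, rfl, rfl, hx⟩ := List.map_eq_append_iff.1 hs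
    obtain ⟨i, v, rfl, rfl, rfl⟩ := List.map_eq_cons_iff.1 hx
    exact ⟨_, _, .of_rewiring (p' := u ++ i :: i :: v) [q] (by simp) fun M => by
      simpa using Gate.Maps.fork (u.map M) (v.map M) (M i)⟩
  | swap =>
    obtain ⟨u, x, rfl, rfl, hx⟩ := List.map_eq_append_iff.1 hs
    obtain ⟨i, y, rfl, rfl, hy⟩ := List.map_eq_cons_iff.1 hx
    obtain ⟨v, z, rfl, rfl, hz⟩ := List.map_eq_append_iff.1 hy
    obtain ⟨j, w, rfl, rfl, rfl⟩ := List.map_eq_cons_iff.1 hz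
    exact ⟨_, _, .of_rewiring (p' := u ++ j :: (v ++ i :: w)) [q] (by grind) fun M => by
      simpa using Gate.Maps.swap (u.map M) (v.map M) (w.map M) (M i) (M j)⟩

theorem exists_gate (G : Gate) {q : ι} (hq : q ∉ p) : ∃ l p', Simulates l [G] [q] p p' := by
  by_cases hG : ∃ M t, G.Maps (p.map M) t
  · obtain ⟨M, t, hG⟩ := hG
    exact exists_gate_of_maps hq hG
  · push Not at hG
    exact ⟨_, _, .of_forall_not_maps [q] p hG⟩

theorem exists_gates (hlen : L.length ≤ fresh.length) (hnodup : fresh.Nodup)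
    (hp : p.Disjoint fresh) : ∃ l p', Simulates l L fresh p p' := by
  induction L generalizing p fresh with
  | nil => exact ⟨_, _, nil fresh p⟩
  | cons G L ih =>
    obtain ⟨q, fresh, rfl⟩ := List.exists_cons_of_length_pos (Nat.zero_lt_of_lt hlen)
    obtain ⟨l, p', h⟩ := exists_gate G (fun hq => hp hq List.mem_cons_self : q ∉ p)
    have hp' : p'.Disjoint fresh := by grind [h.wires_subset, List.Disjoint]
    obtain ⟨l', p'', h'⟩ := ih (Nat.le_of_succ_le_succ hlen) hnodup.of_cons hp'
    exact ⟨_, _, h.cons h' (List.singleton_disjoint.2 (List.nodup_cons.1 hnodup).1)⟩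

end Simulates

section Circuit

open XorGate

variable {ι : Type*} [DecidableEq ι] {m n : ℕ} {fresh : List ι}

theorem Circuit.Computes.exists_xorGates {C : Circuit m n}
    {f : List.Vector Bool m → List.Vector Bool n} (hC : C.Computes f) {X : Fin m → ι}
    {Y : Fin n → ι} (hY : Y.Injective) (hXY : ∀ i j, X i ≠ Y j)
    (hlen : C.gates.length ≤ fresh.length) (hnodup : fresh.Nodup) (hXfresh : ∀ i, X i ∉ fresh)
    (hYfresh : ∀ j, Y j ∉ fresh) :
    ∃ l : List (XorGate ι), l.length ≤ 2 * C.gates.length + n ∧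
      ∀ M, (∀ i ∈ fresh, M i = false) →
        runAll l M = M ∆ loadRegister Y (f (readRegister X M)) := by
  obtain ⟨l, p, hl⟩ := Simulates.exists_gates hlen hnodup
    (p := List.ofFn X) (by simpa [List.Disjoint, List.forall_mem_ofFn_iff] using hXfresh)
  have map_runAll {M : ι → Bool} (hM : ∀ i ∈ fresh, M i = false) :
      p.map (runAll l M) = (f (readRegister X M)).toList :=
    hl.map_runAll M _ hM (toList_readRegister X M ▸ hC (readRegister X M))
  have hplen : p.length = n := by
    simpa using congrArg List.length (map_runAll (M := fun _ => false) fun _ _ => rfl)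
  let P : List.Vector ι n := ⟨p, hplen⟩
  have hY_not_mem (j : Fin n) : Y j ∉ List.ofFn X ++ fresh := by
    simpa [List.mem_ofFn, hYfresh j] using fun i => hXY i j
  have hPY (i j : Fin n) : P.get i ≠ Y j := fun h =>
    hY_not_mem j (h ▸ hl.wires_subset (P.get_mem i))
  have readRegister_runAll {M : ι → Bool} (hM : ∀ i ∈ fresh, M i = false) :
      readRegister P.get (runAll l M) = f (readRegister X M) := by
    refine List.Vector.eq _ _ ?_
    rw [toList_readRegister, ← List.Vector.toList_ofFn, P.ofFn_get, ← map_runAll hM]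
    rfl
  refine ⟨l ++ (copyGates P.get Y hPY ++ l.reverse), ?_, fun M hM => ?_⟩
  · have := hl.length_le
    simp only [List.length_append, List.length_reverse, length_copyGates]
    omega
  · have control_eq_false {i : ι} (hi : i ∈ List.ofFn X ++ fresh) :
        loadRegister Y (f (readRegister X M)) i = false :=
      loadRegister_of_forall_ne _ fun j hj => hY_not_mem j (hj ▸ hi)
    rw [runAll_append, runAll_append, runAll_copyGates hY, readRegister_runAll hM,
      runAll_symmDiff fun o ho => ?_, runAll_reverse_runAll]
    have := hl.control_mem o (List.mem_reverse.1 ho)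
    exact ⟨control_eq_false this.1, control_eq_false this.2⟩

theorem Circuit.Computes.exists_xorGates_perm {g : Equiv.Perm (List.Vector Bool m)}
    {C D : Circuit m m} (hC : C.Computes g) (hD : D.Computes g.symm) {X Y : Fin m → ι}
    (hX : X.Injective) (hY : Y.Injective) (hXY : ∀ i j, X i ≠ Y j)
    (hlenC : C.gates.length ≤ fresh.length) (hlenD : D.gates.length ≤ fresh.length)
    (hnodup : fresh.Nodup) (hXfresh : ∀ i, X i ∉ fresh) (hYfresh : ∀ j, Y j ∉ fresh) :
    ∃ l : List (XorGate ι), l.length ≤ 2 * (C.size + D.size) ∧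
      ∀ x, runAll l (loadRegister X x) = loadRegister X (g x) := by
  have hYX (i j : Fin m) : Y i ≠ X j := (hXY j i).symm
  obtain ⟨lC, hlC, hrunC⟩ := hC.exists_xorGates hY hXY hlenC hnodup hXfresh hYfresh
  obtain ⟨lD, hlD, hrunD⟩ := hD.exists_xorGates hX hYX hlenD hnodup hYfresh hXfresh
  have clean {r : Fin m → ι} (hr : ∀ j, r j ∉ fresh) (x : List.Vector Bool m) :
      ∀ i ∈ fresh, loadRegister r x i = false :=
    fun i hi => loadRegister_of_forall_ne x fun j hj => hr j (hj ▸ hi)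
  refine ⟨lC ++ lD ++ copyGates Y X hYX ++ copyGates X Y hXY, ?_, fun x => ?_⟩
  · simp only [List.length_append, length_copyGates, Circuit.size]
    omega
  have clean_XY : ∀ i ∈ fresh, (loadRegister X x ∆ loadRegister Y (g x)) i = false := fun i hi => by
    rw [Pi.symmDiff_apply, clean hXfresh x i hi, clean hYfresh (g x) i hi,
      Bool.symmDiff_eq_xor, Bool.xor_false]
  have compute : runAll lC (loadRegister X x) = loadRegister X x ∆ loadRegister Y (g x) := by
    rw [hrunC _ (clean hXfresh x), readRegister_loadRegister hX]
  have erase_input :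
      runAll lD (loadRegister X x ∆ loadRegister Y (g x)) = loadRegister Y (g x) := by
    rw [hrunD _ clean_XY, symmDiff_comm (loadRegister X x),
      readRegister_symmDiff_loadRegister hXY, readRegister_loadRegister hY, Equiv.symm_apply_apply,
      symmDiff_symmDiff_cancel_right]
  have copy_back : runAll (copyGates Y X hYX) (loadRegister Y (g x)) =
      loadRegister Y (g x) ∆ loadRegister X (g x) := by
    rw [runAll_copyGates hX, readRegister_loadRegister hY]
  have erase_copy :
      runAll (copyGates X Y hXY) (loadRegister Y (g x) ∆ loadRegister X (g x)) =
        loadRegister X (g x) := by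
    rw [runAll_copyGates hY, symmDiff_comm (loadRegister Y (g x)),
      readRegister_symmDiff_loadRegister hYX, readRegister_loadRegister hX,
      symmDiff_symmDiff_cancel_right]
  rw [runAll_append, runAll_append, runAll_append, compute, erase_input, copy_back, erase_copy]

end Circuit

/-! ### Reversible gates as words -/

/-- The transformation `P` of the memories with `N` cells is carried out by a word with at most
`ℓ` letters, which are letters of `Γ` and transpositions of two of the first `N` positions; the
memory `M` is encoded as the string `M 0 … M (N - 1)`. -/
def Realizes (Γ : Set ThompsonG) (N ℓ : ℕ) (P : (Fin N → Bool) → Fin N → Bool) : Prop :=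
  ∃ a, HasWord Γ N ℓ a ∧ ∀ M, List.ofFn (P M) ∈ a.toPEquiv (List.ofFn M)

theorem swapLetters_ofFn {N : ℕ} (i j : Fin N) (M : Fin N → Bool) :
    swapLetters i j (List.ofFn M) = List.ofFn (M ∘ Equiv.swap i j) := by
  refine List.ext_getElem (by simp) fun k _ hk => ?_
  have hkN : k < N := by simpa using hk
  have swap_val : Equiv.swap (i : ℕ) j k = Equiv.swap i j ⟨k, hkN⟩ :=
    Fin.val_injective.swap_apply i j ⟨k, hkN⟩
  rw [getElem_swapLetters, swap_val, List.getD_eq_getElem _ _ (by simp), List.getElem_ofFn,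
    List.getElem_ofFn, Function.comp_apply]

namespace Realizes

variable {Γ : Set ThompsonG} {N ℓ ℓ' K : ℕ} {P Q : (Fin N → Bool) → Fin N → Bool}

theorem mono (hP : Realizes Γ N ℓ P) (hℓ : ℓ ≤ ℓ') : Realizes Γ N ℓ' P :=
  hP.imp fun _ h => ⟨h.1.mono le_rfl hℓ, h.2⟩

theorem id : Realizes Γ N 0 _root_.id :=
  ⟨1, HasWord.one, fun M => ThompsonG.mem_one (List.ofFn M)⟩

theorem comp (hP : Realizes Γ N ℓ P) (hQ : Realizes Γ N ℓ' Q) : Realizes Γ N (ℓ + ℓ') (P ∘ Q) := by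
  obtain ⟨a, ha, hPa⟩ := hP
  obtain ⟨b, hb, hQb⟩ := hQ
  exact ⟨a * b, ha.mul hb, fun M => ThompsonG.mul_apply (hQb M) (hPa (Q M))⟩

theorem of_rightInverse (hP : Realizes Γ N ℓ P) (hQ : Function.RightInverse Q P) :
    Realizes Γ N ℓ Q := by
  obtain ⟨a, ha, hPa⟩ := hP
  refine ⟨a⁻¹, ha.inv, fun M => ThompsonG.mem_inv.2 ?_⟩
  simpa only [hQ M] using hPa (Q M)

theorem perm_mul {σ τ : Equiv.Perm (Fin N)} (hσ : Realizes Γ N ℓ (· ∘ σ))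
    (hτ : Realizes Γ N ℓ' (· ∘ τ)) : Realizes Γ N (ℓ + ℓ') (· ∘ ⇑(σ * τ)) :=
  (hτ.comp hσ).mono (Nat.add_comm ℓ' ℓ).le

theorem swap_succ {i : ℕ} (hi : i + 1 < N) :
    Realizes Γ N 1 (· ∘ Equiv.swap ⟨i, Nat.lt_of_succ_lt hi⟩ ⟨i + 1, hi⟩) := by
  refine ⟨tau (i + 1) (i + 2) i.succ_pos (i + 1).lt_succ_self,
    HasWord.tau_succ i.succ_pos hi, fun M => ?_⟩
  refine le_maxExt (tauPEquiv_isEssIso _ _ _ _) _ _ (mem_tauPEquiv.2 ⟨?_, ?_⟩)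
  · rw [List.length_ofFn]
    exact hi
  · exact (swapLetters_ofFn ⟨i, Nat.lt_of_succ_lt hi⟩ ⟨i + 1, hi⟩ M).symm

theorem swap_add {i d : ℕ} (hd : i + d + 1 < N) :
    Realizes Γ N (2 * d + 1) (· ∘ Equiv.swap ⟨i, by omega⟩ ⟨i + d + 1, hd⟩) := by
  induction d with
  | zero => exact swap_succ hd
  | succ d ih =>
    let j : Fin N := ⟨i, by omega⟩
    let k : Fin N := ⟨i + d + 1, by omega⟩
    let k' : Fin N := ⟨i + d + 2, hd⟩
    have hk : Realizes Γ N 1 (· ∘ Equiv.swap k k') := swap_succ hd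
    have hj : Realizes Γ N (2 * d + 1) (· ∘ Equiv.swap j k) := ih _
    have conj : Equiv.swap k k' * Equiv.swap j k * Equiv.swap k k' = Equiv.swap j k' := by
      have hjk : j ≠ k := Fin.ne_of_val_ne (by grind)
      have hjk' : j ≠ k' := Fin.ne_of_val_ne (by grind)
      rw [Equiv.swap_comm j k', Equiv.swap_mul_swap_mul_swap hjk hjk']
    have realizes_conj : Realizes Γ N _ (· ∘ Equiv.swap j k') :=
      conj ▸ (hk.perm_mul hj).perm_mul hk
    exact realizes_conj.mono (by omega)

theorem swap (i j : Fin N) : Realizes Γ N (2 * N) (· ∘ Equiv.swap i j) := by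
  wlog hij : i ≤ j
  · rw [Equiv.swap_comm]
    exact this j i (le_of_not_ge hij)
  obtain rfl | hlt := hij.eq_or_lt
  · rw [Equiv.swap_self]
    exact id.mono (Nat.zero_le _)
  · obtain ⟨d, hd⟩ := Nat.exists_eq_add_of_lt hlt
    have hj : j = ⟨i + d + 1, hd ▸ j.2⟩ := Fin.ext hd
    rw [hj]
    exact (swap_add (hd ▸ j.2)).mono (by omega)

theorem exists_perm_extending {k : ℕ} (hk : k ≤ N) {e : Fin k → Fin N} (he : e.Injective) :
    ∃ π : Equiv.Perm (Fin N), (∀ i, π (Fin.castLE hk i) = e i) ∧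
      Realizes Γ N (k * (2 * N)) (· ∘ π) := by
  induction k with
  | zero => exact ⟨1, fun i => i.elim0, id.mono (Nat.zero_le _)⟩
  | succ k ih =>
    obtain ⟨π, hπ, hreal⟩ := ih (Nat.le_of_succ_le hk) (he.comp (Fin.castSucc_injective k))
    refine ⟨Equiv.swap (π (Fin.castLE hk (Fin.last k))) (e (Fin.last k)) * π, fun i => ?_, ?_⟩
    · induction i using Fin.lastCases with
      | last => exact Equiv.swap_apply_left _ _
      | cast i =>
        have hi : π (Fin.castLE hk i.castSucc) = e i.castSucc := hπ i
        rw [Equiv.Perm.mul_apply, hi]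
        refine Equiv.swap_apply_of_ne_of_ne (fun h => ?_) (he.ne (Fin.castSucc_ne_last i))
        exact Fin.castSucc_ne_last i (Fin.castLE_injective hk (π.injective (hi.trans h)))
    · exact ((swap _ _).perm_mul hreal).mono (le_of_eq (by ring))

theorem xor_front {n : ℕ} {f : Bool → Bool → Bool} (hf : HasWord Γ 0 K (xorElt f)) :
    Realizes Γ (n + 3) K (fun M => Function.update M 2 (M 2 ^^ f (M 0) (M 1))) := by
  refine ⟨xorElt f, hf.mono (Nat.zero_le _) le_rfl, fun M => ?_⟩
  have later (i : Fin n) : i.succ.succ.succ ≠ 2 := fun h =>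
    i.succ_ne_zero (Fin.succ_inj.1 (Fin.succ_inj.1 h))
  simp only [List.ofFn_succ, Function.update_of_ne (later _)]
  exact xorElt_apply f (M 0) (M 1) (M 2) _

theorem run_of_controls_ne (hN : 3 ≤ N) {o : XorGate (Fin N)} (hne : o.control₁ ≠ o.control₂)
    (hK : HasWord Γ 0 K (xorElt o.func)) : Realizes Γ N (12 * N + K) o.run := by
  obtain ⟨n, rfl⟩ := Nat.exists_eq_add_of_le' hN
  have hwires : Function.Injective ![o.control₁, o.control₂, o.target] := by
    have h₁ := o.control₁_ne_target
    have h₂ := o.control₂_ne_target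
    intro i j
    fin_cases i <;> fin_cases j <;> simp [hne, hne.symm, h₁, h₂, h₁.symm, h₂.symm]
  obtain ⟨π, hπ, hreal⟩ := exists_perm_extending (Γ := Γ) hN hwires
  have hreal_symm : Realizes Γ (n + 3) (3 * (2 * (n + 3))) (· ∘ π.symm) :=
    hreal.of_rightInverse fun M => by simp [Function.comp_assoc]
  have run_eq : o.run = (· ∘ π.symm) ∘
      (fun M => Function.update M 2 (M 2 ^^ o.func (M 0) (M 1))) ∘ (· ∘ π) := by
    have h₀ : π 0 = o.control₁ := hπ 0
    have h₁ : π 1 = o.control₂ := hπ 1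
    have h₂ : π 2 = o.target := hπ 2
    funext M
    simp only [Function.comp_apply, Function.update_comp_equiv, Equiv.symm_symm, h₀, h₁, h₂,
      Function.comp_assoc, Equiv.self_comp_symm, Function.comp_id, XorGate.run]
  rw [run_eq]
  exact (hreal_symm.comp ((xor_front hK).comp hreal)).mono (by omega)

theorem run (hN : 3 ≤ N) (hK : ∀ f, HasWord Γ 0 K (xorElt f)) (o : XorGate (Fin N)) :
    Realizes Γ N (12 * N + K) o.run := by
  obtain hne | heq := ne_or_eq o.control₁ o.control₂
  · exact run_of_controls_ne hN hne (hK _)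
  obtain ⟨j, hj_control, hj_target⟩ :=
    Fin.exists_ne_and_ne_of_two_lt o.control₁ o.target hN
  let o' : XorGate (Fin N) :=
    { o with control₂ := j, func := fun a _ => o.func a a, control₂_ne_target := hj_target }
  have run_eq : o.run = o'.run := by
    funext M
    simp only [XorGate.run, o', heq]
  rw [run_eq]
  exact run_of_controls_ne hN hj_control.symm (hK _)

theorem runAll (hN : 3 ≤ N) (hK : ∀ f, HasWord Γ 0 K (xorElt f)) (l : List (XorGate (Fin N))) :
    Realizes Γ N (l.length * (12 * N + K)) (XorGate.runAll l) := by
  induction l with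
  | nil => exact id.mono (Nat.zero_le _)
  | cons o l ih => exact (ih.comp (run hN hK o)).mono (Nat.succ_mul _ _).ge

end Realizes

theorem ofFn_loadRegister_natAdd {m : ℕ} (n : ℕ) (x : List.Vector Bool m) :
    List.ofFn (loadRegister (Fin.natAdd n) x) = List.replicate n false ++ x.toList := by
  have work_bit (i : Fin n) :
      loadRegister (Fin.natAdd n) x (Fin.castLE (Nat.le_add_right n m) i) = false :=
    loadRegister_of_forall_ne x fun j => Fin.ne_of_val_ne (Nat.ne_of_gt (Nat.lt_add_right j i.2))
  simp only [List.ofFn_add, work_bit, loadRegister_apply (Fin.natAdd_injective m n),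
    List.ofFn_const]
  rw [← List.Vector.toList_ofFn, List.Vector.ofFn_get]

theorem Realizes.exists_hasWord {Γ : Set ThompsonG} {k m ℓ K : ℕ}
    {P : (Fin (k + 1 + m) → Bool) → Fin (k + 1 + m) → Bool} (hP : Realizes Γ (k + 1 + m) ℓ P)
    (hshift : HasWord Γ 0 K shiftElt) {f : List.Vector Bool m → List.Vector Bool m}
    (hf : ∀ x, P (loadRegister (Fin.natAdd (k + 1)) x) =
      loadRegister (Fin.natAdd (k + 1)) (f x)) :
    ∃ a, HasWord Γ (k + 1 + m) (k * K + ℓ + k * K) a ∧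
      ∀ x, false :: (f x).toList ∈ a.toPEquiv (false :: x.toList) := by
  obtain ⟨a, ha, hPa⟩ := hP
  have hpow : HasWord Γ (k + 1 + m) (k * K) (shiftElt ^ k) :=
    (hshift.pow k).mono (Nat.zero_le _) le_rfl
  refine ⟨(shiftElt ^ k)⁻¹ * a * shiftElt ^ k, (hpow.inv.mul ha).mul hpow, fun x => ?_⟩
  have run := hPa (loadRegister (Fin.natAdd (k + 1)) x)
  rw [hf, ofFn_loadRegister_natAdd, ofFn_loadRegister_natAdd] at run
  exact ThompsonG.mul_apply (shiftElt_pow_apply k _)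
    (ThompsonG.mul_apply run (ThompsonG.mem_inv.2 (shiftElt_pow_apply k _)))

theorem Circuit.Computes.exists_xorGates_fin {m n : ℕ} {g : Equiv.Perm (List.Vector Bool m)}
    {C D : Circuit m m} (hC : C.Computes g) (hD : D.Computes g.symm)
    (hnC : m + C.gates.length ≤ n) (hnD : m + D.gates.length ≤ n) :
    ∃ l : List (XorGate (Fin (n + m))), l.length ≤ 2 * (C.size + D.size) ∧
      ∀ x, XorGate.runAll l (loadRegister (Fin.natAdd n) x) =
        loadRegister (Fin.natAdd n) (g x) := by
  let Y : Fin m → Fin (n + m) := Fin.castLE (Nat.le_add_left m n)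
  let fresh : List (Fin (n + m)) := List.ofFn fun j : Fin (n - m) => ⟨m + j, by omega⟩
  have val_mem_Ico {i : Fin (n + m)} (hi : i ∈ fresh) : m ≤ i ∧ i < n := by
    obtain ⟨j, rfl⟩ := List.mem_ofFn.1 hi
    grind
  have hXY (i j : Fin m) : Fin.natAdd n i ≠ Y j := Fin.ne_of_val_ne (by grind)
  have hnodup : fresh.Nodup := List.nodup_ofFn.2 fun i j hij => by grind
  exact hC.exists_xorGates_perm hD (Fin.natAdd_injective m n) (Fin.castLE_injective _) hXY
    (by grind) (by grind) hnodup (fun i hi => by grind) (fun i hi => by grind)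

theorem HasWord.exists_of_computes {Γ : Set ThompsonG} {K m : ℕ} (hshift : HasWord Γ 0 K shiftElt)
    (hxor : ∀ f, HasWord Γ 0 K (xorElt f)) {g : Equiv.Perm (List.Vector Bool m)}
    {C D : Circuit m m} (hC : C.Computes g) (hD : D.Computes g.symm) :
    ∃ a, HasWord Γ (max C.size D.size + 1) ((96 + 6 * K) * (C.size ^ 2 + D.size ^ 2)) a ∧
      ∀ x, false :: (g x).toList ∈ a.toPEquiv (false :: x.toList) := by
  obtain rfl | hm := m.eq_zero_or_pos
  · refine ⟨1, HasWord.one, fun x => ?_⟩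
    rw [Subsingleton.elim (g x) x]
    exact ThompsonG.mem_one _
  let G := max C.gates.length D.gates.length
  let s := max C.size D.size
  have hCs : C.size ≤ s := le_max_left _ _
  have hDs : D.size ≤ s := le_max_right _ _
  have hs : m + G + 1 + m = s + 1 := by grind [Circuit.size]
  obtain ⟨l, hlen, hl⟩ := hC.exists_xorGates_fin hD (n := m + G + 1) (by omega) (by omega)
  have hN : 3 ≤ m + G + 1 + m := by omega
  obtain ⟨a, ha, hga⟩ := (Realizes.runAll hN hxor l).exists_hasWord hshift hl
  refine ⟨a, ha.mono (by omega) ?_, hga⟩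
  calc (m + G) * K + l.length * (12 * (m + G + 1 + m) + K) + (m + G) * K
      ≤ s * K + 4 * s * (12 * (s + 1) + K) + s * K := by
        gcongr ?_ * K + ?_ * (12 * ?_ + K) + ?_ * K <;> omega
    _ ≤ (96 + 6 * K) * s ^ 2 := by nlinarith [Nat.le_self_pow two_ne_zero s]
    _ ≤ (96 + 6 * K) * (C.size ^ 2 + D.size ^ 2) := by
      gcongr
      obtain h | h := max_choice C.size D.size <;> simp [s, h]

theorem mainTheorem4_general (Γ : Set ThompsonG) (hgen : Subgroup.closure Γ = ⊤) :
    ∃ c : ℕ, ∀ (m : ℕ) (g : Equiv.Perm (List.Vector Bool m)) (Cg Cginv : Circuit m m),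
      Cg.Computes g → Cginv.Computes g.symm →
      ∃ W : GroupWord Γ,
        (∀ x : List.Vector Bool m,
          W.value.toPEquiv (false :: x.toList) = some (false :: (g x).toList)) ∧
        (∀ y : List.Vector Bool m,
          (W.value⁻¹).toPEquiv (false :: y.toList) = some (false :: (g.symm y).toList)) ∧
        GroupWord.value (FreeGroup.invRev W) = W.value⁻¹ ∧
        W.value.Stabilizes false ∧ W.value.Stabilizes true ∧
        (W.value⁻¹).Stabilizes false ∧ (W.value⁻¹).Stabilizes true ∧
        W.length = (FreeGroup.invRev W).length ∧
        W.length ≤ c * (Cg.size ^ 2 + Cginv.size ^ 2) ∧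
        ∀ (i : ℕ) (hi : 1 ≤ i) (e : Bool), (Letter.trans i hi, e) ∈ W →
          i + 1 ≤ max Cg.size Cginv.size + 1 := by
  obtain ⟨K, hK⟩ := HasWord.exists_uniform (Γ := Γ) (N := 0)
    ((Set.finite_range xorElt).insert shiftElt) (by simp [hgen])
  refine ⟨96 + 6 * K, fun m g Cg Cginv hCg hCginv => ?_⟩
  obtain ⟨_, ⟨W, rfl, hlen, hsub⟩, happly⟩ := HasWord.exists_of_computes
    (hK _ (Set.mem_insert _ _)) (fun f => hK _ (Set.mem_insert_of_mem _ ⟨f, rfl⟩)) hCg hCginv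
  have happly_inv (y : List.Vector Bool m) :
      false :: (g.symm y).toList ∈ (W.value⁻¹).toPEquiv (false :: y.toList) :=
    ThompsonG.mem_inv.2 (by simpa only [g.apply_symm_apply] using happly (g.symm y))
  have hstab : W.value.Stabilizes false :=
    ThompsonG.stabilizes_of_forall_length_eq fun x hx => ⟨_, happly ⟨x, hx⟩⟩
  have hstab_inv : (W.value⁻¹).Stabilizes false :=
    ThompsonG.stabilizes_of_forall_length_eq fun y hy => ⟨_, happly_inv ⟨y, hy⟩⟩
  exact ⟨W, happly, happly_inv, GroupWord.value_invRev W, hstab, hstab_inv.not_of_inv, hstab_inv,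
    ThompsonG.Stabilizes.not_of_inv ((inv_inv W.value).symm ▸ hstab), FreeGroup.invRev_length.symm,
    hlen, hsub⟩

theorem mainTheorem4 (Γ : Set ThompsonG) (hfin : Γ.Finite)
    (hgen : Subgroup.closure Γ = ⊤) :
    ∃ c : ℕ, ∀ (m : ℕ) (g : Equiv.Perm (List.Vector Bool m)) (Cg Cginv : Circuit m m),
      Cg.IsMinimumFor g → Cginv.IsMinimumFor g.symm →
      ∃ W : GroupWord Γ,
        (∀ x : List.Vector Bool m,
          W.value.toPEquiv (false :: x.toList) = some (false :: (g x).toList)) ∧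
        (∀ y : List.Vector Bool m,
          (W.value⁻¹).toPEquiv (false :: y.toList) = some (false :: (g.symm y).toList)) ∧
        GroupWord.value (FreeGroup.invRev W) = W.value⁻¹ ∧
        W.value.Stabilizes false ∧ W.value.Stabilizes true ∧
        (W.value⁻¹).Stabilizes false ∧ (W.value⁻¹).Stabilizes true ∧
        W.length = (FreeGroup.invRev W).length ∧
        W.length ≤ c * (Cg.size ^ 4 + Cginv.size ^ 4) ∧
        ∀ (i : ℕ) (hi : 1 ≤ i) (e : Bool), (Letter.trans i hi, e) ∈ W →
          i + 1 ≤ max (Cg.size ^ 2) (Cginv.size ^ 2) + 2 := by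
  obtain ⟨c, hc⟩ := mainTheorem4_general Γ hgen
  refine ⟨c, fun m g Cg Cginv hCg hCginv => ?_⟩
  obtain ⟨W, hg, hginv, hvalue, hstab₀, hstab₁, hinv₀, hinv₁, hrev, hlen, hsub⟩ :=
    hc m g Cg Cginv hCg.1 hCginv.1
  have sq_le_pow_four (n : ℕ) : n ^ 2 ≤ n ^ 4 :=
    (Nat.le_self_pow two_ne_zero (n ^ 2)).trans_eq (pow_mul n 2 2).symm
  have le_sq (n : ℕ) : n ≤ n ^ 2 := Nat.le_self_pow two_ne_zero n
  exact ⟨W, hg, hginv, hvalue, hstab₀, hstab₁, hinv₀, hinv₁, hrev,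
    hlen.trans (Nat.mul_le_mul_left c (Nat.add_le_add (sq_le_pow_four _) (sq_le_pow_four _))),
    fun i hi e he => (hsub i hi e he).trans
      (Nat.add_le_add (max_le_max (le_sq _) (le_sq _)) one_le_two)⟩
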